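/- For a group $G$ with a finite generating set $S$ let $\ell_S$ be the word length (with respect to $S\cup S^{-1}$). For conjugate $h,h'\in G$ put $\mathrm{cl}(h,h')=\min\{\ell_S(k): khk^{-1}=h'\}$, and let the conjugator length function of $G$ be $$\mathrm{CLF}_S(n)=\max\{\mathrm{cl}(h,h') : h\sim h',\ \ell_S(h)+\ell_S(h')\le n\}.$$ For functions $f,g$ from the non-negative integers to themselves write $f\preceq g$ if there are integers $C\ge 1$, $D\ge 0$ such that $f(n)\le C\,g(Cn+D)+D$ for all $n$; say that $f$ *grows linearly* if $f\preceq (n\mapsto n)$ and $(n\mapsto n)\preceq f$. A *crystallographic group* is a discrete cocompact subgroup $H$ of $\mathrm{Isom}(\mathbb{E}^n)$; it is *split* if, for some choice of an origin $o\in\mathbb{E}^n$, it is the semidirect product $H=T_H\rtimes H_0$ of its subgroup $T_H$ of translations and the subgroup $H_0$ of the elements that fix $o$. An *affine Coxeter group* is a group isomorphic to a discrete cocompact subgroup of $\mathrm{Isom}(\mathbb{E}^n)$, for some $n\ge 1$, that is generated by orthogonal reflections in affine hyperplanes. 1. Every affine Coxeter group $W$ is finitely generated, and for each finite generating set $S$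 of $W$ the function $\mathrm{CLF}_S$ grows linearly. 2. Every split crystallographic group $H$ is finitely generated, and for each finite generating set $S$ of $H$ the function $\mathrm{CLF}_S$ grows linearly if $H$ is not abelian, and is constant equal to $0$ if $H$ is abelian. -/

import Mathlib

/-! ### Word length and conjugator length in a group with a generating set -/

section ConjugatorLength

variable {G : Type*} [Group G]

/-- The word length of `g` with respect to a generating set `S`: the least length of a word in
the letters `S ∪ S⁻¹` that represents `g`. -/
noncomputable def wordLength (S : Set G) (g : G) : ℕ :=
  sInf {k : ℕ | ∃ l : List G, (∀ x ∈ l, x ∈ S ∨ x⁻¹ ∈ S) ∧ l.prod = g ∧ l.length = k}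

/-- The conjugator length of two conjugate elements: the least word length of an element `k`
with `k h k⁻¹ = h'`. -/
noncomputable def conjugatorLength (S : Set G) (h h' : G) : ℕ :=
  sInf {m : ℕ | ∃ k : G, k * h * k⁻¹ = h' ∧ wordLength S k = m}

/-- The conjugator lengths of all pairs of conjugate elements of total word length at most `n`. -/
def conjugatorLengths (S : Set G) (n : ℕ) : Set ℕ :=
  {m : ℕ | ∃ h h' : G, IsConj h h' ∧ wordLength S h + wordLength S h' ≤ n ∧
    conjugatorLength S h h' = m}

/-- The conjugator length function: the largest conjugator length of a pair of conjugate elements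
of total word length at most `n`. For a finite generating set the supremum is a maximum, see
`isGreatest_conjugatorLengthFunction`. -/
noncomputable def conjugatorLengthFunction (S : Set G) (n : ℕ) : ℕ :=
  sSup (conjugatorLengths S n)

theorem exists_word (S : Set G) (hS : Subgroup.closure S = ⊤) (g : G) :
    ∃ l : List G, (∀ x ∈ l, x ∈ S ∨ x⁻¹ ∈ S) ∧ l.prod = g ∧ l.length = wordLength S g := by
  have hg : g ∈ Subgroup.closure S := by rw [hS]; trivial
  rw [← Subgroup.mem_toSubmonoid, Subgroup.closure_toSubmonoid] at hg
  obtain ⟨l, hl, hp⟩ := Submonoid.exists_list_of_mem_closure hg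
  exact Nat.sInf_mem (s := {k : ℕ | ∃ l : List G, (∀ x ∈ l, x ∈ S ∨ x⁻¹ ∈ S) ∧ l.prod = g ∧
    l.length = k}) ⟨_, l, hl, hp, rfl⟩

theorem finite_wordLength_le (S : Set G) (hfin : S.Finite) (hS : Subgroup.closure S = ⊤) (n : ℕ) :
    {g : G | wordLength S g ≤ n}.Finite := by
  have key : ∀ k : ℕ, {g : G | ∃ l : List G, (∀ x ∈ l, x ∈ S ∨ x⁻¹ ∈ S) ∧ l.prod = g ∧
      l.length = k}.Finite := by
    intro k
    induction k with
    | zero =>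
      refine (Set.finite_singleton (1 : G)).subset ?_
      rintro g ⟨l, -, rfl, hl⟩
      simp [List.length_eq_zero_iff.mp hl]
    | succ k ih =>
      have hfin' : (S ∪ (fun x : G => x⁻¹) '' S).Finite := hfin.union (hfin.image _)
      refine (Set.Finite.image2 (fun a b : G => a * b) hfin' ih).subset ?_
      rintro g ⟨l, hl, rfl, hlen⟩
      cases l with
      | nil => simp at hlen
      | cons a t =>
        refine ⟨a, ?_, t.prod, ⟨t, fun x hx => hl x (by simp [hx]), rfl, by simpa using hlen⟩,
          by simp⟩
        rcases hl a (by simp) with h | h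
        · exact Or.inl h
        · exact Or.inr ⟨a⁻¹, h, inv_inv a⟩
  refine ((Set.finite_Iic n).biUnion fun k _ => key k).subset ?_
  intro g hg
  obtain ⟨l, h1, h2, h3⟩ := exists_word S hS g
  exact Set.mem_biUnion (show wordLength S g ∈ Set.Iic n from hg) ⟨l, h1, h2, h3⟩

theorem isGreatest_conjugatorLengthFunction (S : Set G) (hfin : S.Finite)
    (hS : Subgroup.closure S = ⊤) (n : ℕ) :
    IsGreatest (conjugatorLengths S n) (conjugatorLengthFunction S n) := by
  have hone : wordLength S (1 : G) = 0 :=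
    Nat.sInf_eq_zero.mpr (Or.inl ⟨[], by simp, by simp, rfl⟩)
  have hne : (conjugatorLengths S n).Nonempty :=
    ⟨_, 1, 1, IsConj.refl 1, by simp [hone], rfl⟩
  have hb := finite_wordLength_le S hfin hS n
  have hf : (conjugatorLengths S n).Finite := by
    refine (Set.Finite.image2 (fun h h' => conjugatorLength S h h') hb hb).subset ?_
    rintro m ⟨h, h', -, hle, rfl⟩
    exact ⟨h, le_trans (Nat.le_add_right _ _) hle, h', le_trans (Nat.le_add_left _ _) hle, rfl⟩
  exact ⟨Nat.sSup_mem hne hf.bddAbove, fun m hm => le_csSup hf.bddAbove hm⟩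

end ConjugatorLength

/-! ### Growth of functions -/

/-- `g` quasi-dominates `f`: there is an increasing affine function `a x = C x + D` on the
non-negative integers, `C ≥ 1`, with `f n ≤ a (g (a n))` for all `n`. -/
def QuasiDominated (f g : ℕ → ℕ) : Prop :=
  ∃ C D : ℕ, 1 ≤ C ∧ ∀ n : ℕ, f n ≤ C * g (C * n + D) + D

def QuasiEquivalent (f g : ℕ → ℕ) : Prop :=
  QuasiDominated f g ∧ QuasiDominated g f

/-- Linear growth (from above and from below). -/
def GrowsLinearly (f : ℕ → ℕ) : Prop :=
  QuasiEquivalent f (fun n => n)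

/-! ### Groups of Euclidean isometries -/

/-- The group of isometries of Euclidean `n`-space (every isometry of it is affine). -/
abbrev EuclideanIsometryGroup (n : ℕ) : Type :=
  EuclideanSpace ℝ (Fin n) ≃ᵃⁱ[ℝ] EuclideanSpace ℝ (Fin n)

/-- A crystallographic group: a subgroup of the isometry group of Euclidean space which is
discrete (it acts properly discontinuously) and cocompact. -/
structure IsCrystallographic {n : ℕ} (H : Subgroup (EuclideanIsometryGroup n)) : Prop where
  properlyDiscontinuous : ∀ K : Set (EuclideanSpace ℝ (Fin n)), IsCompact K →
    {h : EuclideanIsometryGroup n | h ∈ H ∧ ∃ x ∈ K, h x ∈ K}.Finite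
  cocompact : ∃ K : Set (EuclideanSpace ℝ (Fin n)), IsCompact K ∧ ∀ x, ∃ h ∈ H, h x ∈ K

/-- A subgroup `H` of the isometry group splits if, for a suitable choice of the origin `o` of
Euclidean space, it is the (semidirect) product of its subgroup of translations and the subgroup
of those elements that fix `o`. The former is always normal and meets the latter trivially, so it
suffices that each element of `H` is a product of such elements. -/
def IsSplit {n : ℕ} (H : Subgroup (EuclideanIsometryGroup n)) : Prop :=
  ∃ o : EuclideanSpace ℝ (Fin n), ∀ h ∈ H, ∃ v : EuclideanSpace ℝ (Fin n),
    ∃ u : EuclideanIsometryGroup n,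
      AffineIsometryEquiv.constVAdd ℝ (EuclideanSpace ℝ (Fin n)) v ∈ H ∧ u ∈ H ∧ u o = o ∧
        h = AffineIsometryEquiv.constVAdd ℝ (EuclideanSpace ℝ (Fin n)) v * u

/-- The orthogonal reflection in an affine hyperplane `{x | ⟪v, x⟫ = c}`, where `‖v‖ = 1`. -/
def IsAffineReflection {n : ℕ} (r : EuclideanIsometryGroup n) : Prop :=
  ∃ (v : EuclideanSpace ℝ (Fin n)) (c : ℝ), ‖v‖ = 1 ∧
    ∀ x : EuclideanSpace ℝ (Fin n), r x = x - (2 * (inner ℝ v x - c)) • v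

/-- An affine Coxeter group: a group that is isomorphic to a discrete cocompact group of
isometries of a Euclidean space of positive dimension which is generated by reflections in affine
hyperplanes. It need not be irreducible. -/
def IsAffineCoxeterGroup (W : Type*) [Group W] : Prop :=
  ∃ (n : ℕ) (ρ : W →* EuclideanIsometryGroup n), 1 ≤ n ∧ Function.Injective ρ ∧
    IsCrystallographic ρ.range ∧
    Subgroup.closure {r : EuclideanIsometryGroup n | r ∈ ρ.range ∧ IsAffineReflection r} = ρ.range

/-! Both classes of groups act properly and cocompactly on Euclidean space with finite point group.
By the Švarc–Milnor argument, word length and displacement of the origin bound each other linearly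
up to a constant, so conjugators can be measured by displacement.

Upper bound (`IsGeometricAction.exists_short_conjugator`): a conjugator is `u * r` with `u` a
translation and `r` from a finite set. Conjugating `g` by a translation of vector `x` adds the
coboundary `x - A x` to the translation part, `A` being the linear part of `g`; only this coboundary
matters. It is bounded by the displacements of the two conjugates, and
`IsGeometricAction.exists_translation_norm_le` realizes it by a translation of linearly bounded
length. Finitely many `A` occur, so the constants are uniform.

Lower bound: in a non-abelian group the linear part of some `h` moves the vector of some translation
`t`. The conjugates of `h` by `t ^ m` then have displacement growing linearly in `m`, while a short
conjugator cannot lengthen `h` by much.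

The point group of a split group comes from a point stabilizer, finite by properness. For a
reflection group, the unit normals have finitely many mutual inner products, hence are finite in
number, and the point group acts on them faithfully. -/

/-! ### Word length and conjugator length: elementary bounds -/

section WordLength

variable {G : Type*} [Group G]

theorem wordLength_le_length {S : Set G} {l : List G} (hl : ∀ x ∈ l, x ∈ S ∨ x⁻¹ ∈ S) :
    wordLength S l.prod ≤ l.length :=
  Nat.sInf_le ⟨l, hl, rfl, rfl⟩

theorem wordLength_one (S : Set G) : wordLength S (1 : G) = 0 :=
  Nat.le_zero.mp (wordLength_le_length (S := S) (l := []) (by simp))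

theorem wordLength_mul_le {S : Set G} (hS : Subgroup.closure S = ⊤) (g h : G) :
    wordLength S (g * h) ≤ wordLength S g + wordLength S h := by
  obtain ⟨l, hl, hg, hlen⟩ := exists_word S hS g
  obtain ⟨l', hl', hh, hlen'⟩ := exists_word S hS h
  have key := wordLength_le_length (S := S) (l := l ++ l') (by
    intro x hx
    rcases List.mem_append.mp hx with hx | hx
    exacts [hl x hx, hl' x hx])
  rwa [List.prod_append, hg, hh, List.length_append, hlen, hlen'] at key

theorem wordLength_inv_le {S : Set G} (hS : Subgroup.closure S = ⊤) (g : G) :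
    wordLength S g⁻¹ ≤ wordLength S g := by
  obtain ⟨l, hl, hg, hlen⟩ := exists_word S hS g
  have key := wordLength_le_length (S := S) (l := (l.map (·⁻¹)).reverse) (by
    intro x hx
    obtain ⟨y, hy, rfl⟩ := List.mem_map.mp (List.mem_reverse.mp hx)
    simpa [or_comm] using hl y hy)
  rwa [← List.prod_inv_reverse, hg, List.length_reverse, List.length_map, hlen] at key

theorem wordLength_pow_le {S : Set G} (hS : Subgroup.closure S = ⊤) (g : G) (m : ℕ) :
    wordLength S (g ^ m) ≤ m * wordLength S g := by
  induction m with
  | zero => simp [wordLength_one]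
  | succ m ih =>
    rw [pow_succ, add_mul, one_mul]
    exact (wordLength_mul_le hS _ _).trans (by omega)

theorem wordLength_conj_le {S : Set G} (hS : Subgroup.closure S = ⊤) (k h : G) :
    wordLength S (k * h * k⁻¹) ≤ 2 * wordLength S k + wordLength S h := by
  have h1 := wordLength_mul_le hS (k * h) k⁻¹
  have h2 := wordLength_mul_le hS k h
  have h3 := wordLength_inv_le hS k
  omega

theorem conjugatorLength_le {S : Set G} {h h' k : G} (hk : k * h * k⁻¹ = h') :
    conjugatorLength S h h' ≤ wordLength S k :=
  Nat.sInf_le ⟨k, hk, rfl⟩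

theorem exists_conjugator (S : Set G) {h h' : G} (hh : IsConj h h') :
    ∃ k : G, k * h * k⁻¹ = h' ∧ wordLength S k = conjugatorLength S h h' := by
  obtain ⟨k, hk⟩ := isConj_iff.mp hh
  exact Nat.sInf_mem (s := {m : ℕ | ∃ k : G, k * h * k⁻¹ = h' ∧ wordLength S k = m}) ⟨_, k, hk, rfl⟩

theorem conjugatorLengthFunction_eq_zero_of_comm {S : Set G} (hfin : S.Finite)
    (hS : Subgroup.closure S = ⊤) (hcomm : ∀ a b : G, a * b = b * a) (m : ℕ) :
    conjugatorLengthFunction S m = 0 := by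
  obtain ⟨h, h', hh, -, hm⟩ := (isGreatest_conjugatorLengthFunction S hfin hS m).1
  obtain ⟨k, hk⟩ := isConj_iff.mp hh
  rw [← hm]
  refine Nat.le_zero.mp ((conjugatorLength_le (k := 1) ?_).trans_eq (wordLength_one S))
  rw [← hk, hcomm k h]
  simp

end WordLength

theorem QuasiDominated.of_le_affine {f : ℕ → ℕ} {a b : ℕ} (h : ∀ n, f n ≤ a * n + b) :
    QuasiDominated f (fun n => n) := by
  refine ⟨a + 1, b, by omega, fun n => (h n).trans ?_⟩
  nlinarith [Nat.zero_le (a * (a * n)), Nat.zero_le (a * n), Nat.zero_le (a * b)]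

/-! ### The linear part of a Euclidean isometry -/

/-- The linear part of an isometry, as a group homomorphism. -/
noncomputable def linearPart (n : ℕ) :
    EuclideanIsometryGroup n →* (EuclideanSpace ℝ (Fin n) ≃ₗᵢ[ℝ] EuclideanSpace ℝ (Fin n)) where
  toFun e := e.linearIsometryEquiv
  map_one' := rfl
  map_mul' _ _ := rfl

section Action

variable {n : ℕ} {G : Type*} [Group G] (ρ : G →* EuclideanIsometryGroup n)

theorem linearPart_apply_add (e : EuclideanIsometryGroup n) (x y : EuclideanSpace ℝ (Fin n)) :
    e (x + y) = linearPart n e x + e y :=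
  e.map_vadd y x

theorem apply_eq_linearPart_add (e : EuclideanIsometryGroup n) (x : EuclideanSpace ℝ (Fin n)) :
    e x = linearPart n e x + e 0 := by
  simpa using linearPart_apply_add e x 0

theorem ext_of_linearPart {e e' : EuclideanIsometryGroup n} (h : linearPart n e = linearPart n e')
    (h0 : e 0 = e' 0) : e = e' := by
  ext1 x
  rw [apply_eq_linearPart_add e, apply_eq_linearPart_add e', h, h0]

theorem mul_apply_zero (e e' : EuclideanIsometryGroup n) :
    (e * e') 0 = linearPart n e (e' 0) + e 0 :=
  apply_eq_linearPart_add e (e' 0)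

theorem inv_apply_zero (e : EuclideanIsometryGroup n) :
    e⁻¹ 0 = - (linearPart n e)⁻¹ (e 0) := by
  have h := mul_apply_zero e⁻¹ e
  rw [inv_mul_cancel, map_inv] at h
  exact eq_neg_of_add_eq_zero_right h.symm

theorem norm_inv_apply_zero (e : EuclideanIsometryGroup n) : ‖e⁻¹ 0‖ = ‖e 0‖ := by
  rw [inv_apply_zero, norm_neg, LinearIsometryEquiv.norm_map]

theorem norm_mul_apply_zero_le (e e' : EuclideanIsometryGroup n) :
    ‖(e * e') 0‖ ≤ ‖e 0‖ + ‖e' 0‖ := by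
  rw [mul_apply_zero, add_comm ‖e 0‖, ← LinearIsometryEquiv.norm_map (linearPart n e) (e' 0)]
  exact norm_add_le _ _

theorem norm_conj_apply_zero_le (e e' : EuclideanIsometryGroup n) :
    ‖(e * e' * e⁻¹) 0‖ ≤ 2 * ‖e 0‖ + ‖e' 0‖ := by
  have h1 := norm_mul_apply_zero_le (e * e') e⁻¹
  have h2 := norm_mul_apply_zero_le e e'
  rw [norm_inv_apply_zero] at h1
  linarith

/-- Conjugating by a translation changes the translation part by a coboundary. -/
theorem conj_translation_apply_zero {t : EuclideanIsometryGroup n} (ht : linearPart n t = 1)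
    (e : EuclideanIsometryGroup n) :
    (t * e * t⁻¹) 0 = e 0 + (t 0 - linearPart n e (t 0)) := by
  rw [mul_apply_zero, inv_apply_zero, mul_apply_zero, map_mul, ht]
  simp only [one_mul, inv_one, LinearIsometryEquiv.coe_one, id_eq, map_neg]
  abel

theorem translation_pow_apply_zero {t : EuclideanIsometryGroup n} (ht : linearPart n t = 1)
    (m : ℕ) : (t ^ m) 0 = (m : ℝ) • t 0 := by
  induction m with
  | zero => simp
  | succ m ih =>
    rw [pow_succ', mul_apply_zero, ht, ih, Nat.cast_succ, add_smul, one_smul]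
    rfl

/-- Displacement of the origin is subadditive and invariant under inversion, so its maximum on the
generators controls all words. -/
theorem exists_norm_le_mul_wordLength {S : Set G} (hfin : S.Finite)
    (hS : Subgroup.closure S = ⊤) : ∃ M : ℕ, ∀ g : G, ‖ρ g 0‖ ≤ M * wordLength S g := by
  obtain ⟨c, hc⟩ := (hfin.image fun s => ‖ρ s 0‖).bddAbove
  have hc' : ∀ s, s ∈ S ∨ s⁻¹ ∈ S → ‖ρ s 0‖ ≤ ⌈c⌉₊ := by
    rintro s (hs | hs)
    · exact (hc ⟨s, hs, rfl⟩).trans (Nat.le_ceil c)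
    · rw [← norm_inv_apply_zero, ← map_inv]
      exact (hc ⟨s⁻¹, hs, rfl⟩).trans (Nat.le_ceil c)
  have key : ∀ l : List G, (∀ x ∈ l, x ∈ S ∨ x⁻¹ ∈ S) → ‖ρ l.prod 0‖ ≤ ⌈c⌉₊ * l.length := by
    intro l
    induction l with
    | nil => simp
    | cons a l ih =>
      intro hl
      rw [List.prod_cons, map_mul, List.length_cons]
      have h1 := norm_mul_apply_zero_le (ρ a) (ρ l.prod)
      have h2 := hc' a (hl a (by simp))
      have h3 := ih fun x hx => hl x (by simp [hx])
      push_cast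
      linarith
  refine ⟨⌈c⌉₊, fun g => ?_⟩
  obtain ⟨l, hl, hg, hlen⟩ := exists_word S hS g
  rw [← hlen, ← hg]
  exact key l hl

/-! ### Geometric actions and the Švarc–Milnor estimate -/

/-- An isometric action on Euclidean space which is proper and has a coarsely dense orbit. -/
structure IsGeometricAction : Prop where
  finite_norm_le : ∀ r : ℝ, {g : G | ‖ρ g 0‖ ≤ r}.Finite
  coarselyDense : ∃ R : ℝ, 0 ≤ R ∧ ∀ x, ∃ g : G, ‖ρ g 0 - x‖ ≤ R

variable {ρ}

theorem IsCrystallographic.isGeometricAction (hinj : Function.Injective ρ)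
    (h : IsCrystallographic ρ.range) : IsGeometricAction ρ where
  finite_norm_le r := by
    refine Set.Finite.of_finite_image (f := ρ) ?_ hinj.injOn
    refine (h.properlyDiscontinuous _ (isCompact_closedBall 0 r)).subset ?_
    rintro _ ⟨g, hg, rfl⟩
    have hg' : ‖ρ g 0‖ ≤ r := hg
    exact ⟨⟨g, rfl⟩, 0, by simpa using (norm_nonneg _).trans hg', by simpa using hg'⟩
  coarselyDense := by
    obtain ⟨K, hK, hcov⟩ := h.cocompact
    obtain ⟨R, hR⟩ := hK.isBounded.exists_norm_le
    refine ⟨max R 0, le_max_right _ _, fun x => ?_⟩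
    obtain ⟨_, ⟨g, rfl⟩, hg⟩ := hcov x
    -- `g` brings `x` into a bounded set around the origin, so its inverse brings the origin near
    -- `x`.
    refine ⟨g⁻¹, ?_⟩
    have hx : ρ g⁻¹ 0 - x = -(linearPart n (ρ g)).symm (ρ g x) := by
      rw [map_inv, inv_apply_zero, apply_eq_linearPart_add (ρ g) x, map_add,
        LinearIsometryEquiv.symm_apply_apply, neg_add, sub_eq_add_neg, add_comm]
      rfl
    rw [hx, norm_neg, LinearIsometryEquiv.norm_map]
    exact (hR _ hg).trans (le_max_left _ _)

/-- The Švarc–Milnor argument: every group element is a product of boundedly many elements of a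
fixed finite set per unit of displacement. -/
theorem IsGeometricAction.exists_finite_list (hρ : IsGeometricAction ρ) :
    ∃ F : Set G, F.Finite ∧ ∀ g : G, ∃ l : List G, (∀ x ∈ l, x ∈ F) ∧ l.prod = g ∧
      (l.length : ℝ) ≤ ‖ρ g 0‖ + 2 := by
  obtain ⟨R, hR0, hR⟩ := hρ.coarselyDense
  -- Walk along the segment from the origin in steps of length at most 1, with an orbit point within
  -- `R` of each stop: successive orbit points are at most `2 * R + 1` apart.
  refine ⟨{g : G | ‖ρ g 0‖ ≤ 2 * R + 1}, hρ.finite_norm_le _, ?_⟩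
  have key : ∀ (m : ℕ) (g : G) (x : EuclideanSpace ℝ (Fin n)), ‖x‖ ≤ m → ‖ρ g 0 - x‖ ≤ R →
      ∃ l : List G, (∀ y ∈ l, ‖ρ y 0‖ ≤ 2 * R + 1) ∧ l.prod = g ∧ l.length = m + 1 := by
    intro m
    induction m with
    | zero =>
      intro g x hx hg
      have hx0 : x = 0 := by simpa using hx
      rw [hx0, sub_zero] at hg
      exact ⟨[g], by simpa using by linarith, by simp, rfl⟩
    | succ m ih =>
      intro g x hx hg
      have hm : (0 : ℝ) < m + 1 := by positivity
      push_cast at hx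
      set y := ((m : ℝ) / (m + 1)) • x with hy
      have hyn : ‖y‖ ≤ m := by
        rw [hy, norm_smul, Real.norm_of_nonneg (by positivity), div_mul_eq_mul_div, div_le_iff₀ hm]
        gcongr
      have hxy : ‖x - y‖ ≤ 1 := by
        have : x - y = ((1 : ℝ) / (m + 1)) • x := by
          rw [hy, ← one_smul ℝ x, smul_smul, ← sub_smul, smul_smul]
          congr 1
          field_simp
          ring
        rw [this, norm_smul, Real.norm_of_nonneg (by positivity), div_mul_eq_mul_div,
          div_le_iff₀ hm]
        linarith
      obtain ⟨k, hk⟩ := hR y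
      obtain ⟨l, hl, hprod, hlen⟩ := ih k y hyn hk
      refine ⟨l ++ [k⁻¹ * g], ?_, by simp [hprod], by simp [hlen]⟩
      intro z hz
      rcases List.mem_append.mp hz with hz | hz
      · exact hl z hz
      · obtain rfl : z = k⁻¹ * g := by simpa using hz
        have h1 : ρ (k⁻¹ * g) 0 = (linearPart n (ρ k))⁻¹ (ρ g 0 - ρ k 0) := by
          rw [map_mul, map_inv, mul_apply_zero, inv_apply_zero, map_inv, map_sub, sub_eq_add_neg]
        rw [h1, LinearIsometryEquiv.norm_map]
        have h2 : ρ g 0 - ρ k 0 = (ρ g 0 - x) + (x - y) - (ρ k 0 - y) := by abel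
        rw [h2]
        have h3 := norm_sub_le ((ρ g 0 - x) + (x - y)) (ρ k 0 - y)
        have h4 := norm_add_le (ρ g 0 - x) (x - y)
        linarith
  intro g
  obtain ⟨l, hl, hprod, hlen⟩ := key ⌈‖ρ g 0‖⌉₊ g (ρ g 0) (Nat.le_ceil _) (by simpa using hR0)
  refine ⟨l, hl, hprod, ?_⟩
  have := Nat.ceil_lt_add_one (norm_nonneg (ρ g 0))
  rw [hlen]
  push_cast
  linarith

theorem IsGeometricAction.fg (hρ : IsGeometricAction ρ) : Group.FG G := by
  obtain ⟨F, hF, hgen⟩ := hρ.exists_finite_list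
  refine Group.fg_iff.mpr ⟨F, ?_, hF⟩
  rw [eq_top_iff]
  rintro g -
  obtain ⟨l, hl, rfl, -⟩ := hgen g
  exact Subgroup.list_prod_mem _ fun x hx => Subgroup.subset_closure (hl x hx)

theorem IsGeometricAction.exists_wordLength_le (hρ : IsGeometricAction ρ) {S : Set G}
    (hS : Subgroup.closure S = ⊤) :
    ∃ B : ℕ, ∀ g : G, (wordLength S g : ℝ) ≤ B * (‖ρ g 0‖ + 2) := by
  obtain ⟨F, hF, hgen⟩ := hρ.exists_finite_list
  obtain ⟨B, hB⟩ := (hF.image (wordLength S)).bddAbove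
  have key : ∀ l : List G, (∀ x ∈ l, x ∈ F) → wordLength S l.prod ≤ B * l.length := by
    intro l
    induction l with
    | nil => simp [wordLength_one]
    | cons a l ih =>
      intro hl
      have h1 := wordLength_mul_le hS a l.prod
      have h2 : wordLength S a ≤ B := hB ⟨a, hl a (by simp), rfl⟩
      have h3 := ih fun x hx => hl x (by simp [hx])
      rw [List.prod_cons, List.length_cons, mul_add, mul_one]
      omega
  refine ⟨B, fun g => ?_⟩
  obtain ⟨l, hl, rfl, hlen⟩ := hgen g
  calc (wordLength S l.prod : ℝ) ≤ B * l.length := by exact_mod_cast key l hl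
    _ ≤ _ := by gcongr

end Action

/-! ### Finite point group: the linear upper bound -/

section VirtuallyAbelian

variable {n : ℕ} {G : Type*} [Group G] {ρ : G →* EuclideanIsometryGroup n}

theorem Set.Finite.exists_uniform_bound {α : Type*} {s : Set α} (hs : s.Finite) {P : α → ℝ → Prop}
    (hmono : ∀ a b c, b ≤ c → P a b → P a c) (h : ∀ a ∈ s, ∃ c, P a c) :
    ∃ C : ℝ, 0 ≤ C ∧ ∀ a ∈ s, P a C := by
  choose! f hf using h
  obtain ⟨C, hC⟩ := (hs.image f).bddAbove
  exact ⟨max C 0, le_max_right _ _, fun a ha =>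
    hmono a _ _ ((hC ⟨a, ha, rfl⟩).trans (le_max_left _ _)) (hf a ha)⟩

/-- Finitely many elements represent all linear parts. -/
theorem exists_finite_section (hfin : (Set.range fun g => linearPart n (ρ g)).Finite) :
    ∃ F : Set G, F.Finite ∧ ∀ g, ∃ r ∈ F, linearPart n (ρ (g * r⁻¹)) = 1 := by
  have hch : ∀ A ∈ Set.range fun g => linearPart n (ρ g), ∃ r, linearPart n (ρ r) = A :=
    fun _ h => h
  choose! f hf using hch
  refine ⟨f '' _, hfin.image f, fun g => ⟨_, ⟨_, ⟨g, rfl⟩, rfl⟩, ?_⟩⟩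
  rw [map_mul, map_inv, map_mul, map_inv, hf _ ⟨g, rfl⟩, mul_inv_cancel]

/-- Dividing by a representative of the linear part turns any group element into a translation and
moves its orbit point by a bounded amount. -/
theorem IsGeometricAction.translations_coarselyDense (hρ : IsGeometricAction ρ)
    (hfin : (Set.range fun g => linearPart n (ρ g)).Finite) :
    ∃ R : ℝ, 0 ≤ R ∧ ∀ x, ∃ t : G, linearPart n (ρ t) = 1 ∧ ‖ρ t 0 - x‖ ≤ R := by
  obtain ⟨F, hF, hsec⟩ := exists_finite_section hfin
  obtain ⟨R, hR0, hR⟩ := hρ.coarselyDense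
  obtain ⟨C, hC0, hC⟩ := hF.exists_uniform_bound (P := fun r c => ‖ρ r 0‖ ≤ c)
    (fun _ _ _ hbc h => h.trans hbc) fun r _ => ⟨_, le_rfl⟩
  refine ⟨C + R, by positivity, fun x => ?_⟩
  obtain ⟨g, hg⟩ := hR x
  obtain ⟨r, hr, ht⟩ := hsec g
  refine ⟨g * r⁻¹, ht, ?_⟩
  have h1 : ρ g 0 = ρ r 0 + ρ (g * r⁻¹) 0 := by
    have h := mul_apply_zero (ρ (g * r⁻¹)) (ρ r)
    rwa [← map_mul, inv_mul_cancel_right, ht] at h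
  have h2 : ρ (g * r⁻¹) 0 - x = (ρ g 0 - x) - ρ r 0 := by rw [h1]; abel
  rw [h2]
  have := norm_sub_le (ρ g 0 - x) (ρ r 0)
  have := hC r hr
  linarith

/-- A linear isometry fixing a coarsely dense set of vectors is trivial. -/
theorem eq_one_of_fixes_coarselyDense {A : EuclideanSpace ℝ (Fin n) ≃ₗᵢ[ℝ] EuclideanSpace ℝ (Fin n)}
    {T : Set (EuclideanSpace ℝ (Fin n))} {R : ℝ} (hT : ∀ x, ∃ t ∈ T, ‖t - x‖ ≤ R)
    (hA : ∀ t ∈ T, A t = t) : A = 1 := by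
  have hb : ∀ x, ‖A x - x‖ ≤ 2 * R := by
    intro x
    obtain ⟨t, ht, hx⟩ := hT x
    have h1 : A x - x = (t - x) - A (t - x) := by rw [map_sub, hA t ht]; abel
    have h2 := norm_sub_le (t - x) (A (t - x))
    rw [LinearIsometryEquiv.norm_map] at h2
    rw [h1]
    linarith
  ext1 x
  by_contra hne
  have hpos : 0 < ‖A x - x‖ := norm_pos_iff.mpr (sub_ne_zero.mpr hne)
  obtain ⟨m, hm⟩ := exists_nat_gt (2 * R / ‖A x - x‖)
  have h := hb ((m : ℝ) • x)
  rw [map_smul, ← smul_sub, norm_smul, Real.norm_natCast] at h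
  rw [div_lt_iff₀ hpos] at hm
  linarith

/-- The coboundaries `t - A t` of translations `t` have preimages of linearly bounded norm. -/
theorem IsGeometricAction.exists_translation_norm_le (hρ : IsGeometricAction ρ)
    (hfin : (Set.range fun g => linearPart n (ρ g)).Finite) (a : G) :
    ∃ C : ℝ, ∀ u : G, linearPart n (ρ u) = 1 → ∃ t : G, linearPart n (ρ t) = 1 ∧
      ρ t 0 - linearPart n (ρ a) (ρ t 0) = ρ u 0 - linearPart n (ρ a) (ρ u 0) ∧
      ‖ρ t 0‖ ≤ C * (‖ρ u 0 - linearPart n (ρ a) (ρ u 0)‖ + 1) := by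
  obtain ⟨R, hR0, hR⟩ := hρ.translations_coarselyDense hfin
  set A := linearPart n (ρ a) with hA
  let f : EuclideanSpace ℝ (Fin n) →L[ℝ] EuclideanSpace ℝ (Fin n) :=
    ContinuousLinearMap.id ℝ _ - (A.toContinuousLinearEquiv : _ →L[ℝ] _)
  have hf : ∀ x, f x = x - A x := fun x => rfl
  -- The open mapping theorem onto the range of `1 - A` gives short preimages, but these are real
  -- vectors, not translations of the group.
  obtain ⟨c, hc0, hc⟩ := ContinuousLinearMap.exists_preimage_norm_le f.rangeRestrict
    (LinearMap.surjective_rangeRestrict _)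
  let s : Set (EuclideanSpace ℝ (Fin n)) :=
    {z | ∃ u : G, linearPart n (ρ u) = 1 ∧ f (ρ u 0) = z ∧ ‖z‖ ≤ 2 * R}
  have hs : s.Finite := by
    refine ((hρ.finite_norm_le (2 * R)).image fun g => ρ g 0).subset ?_
    rintro z ⟨u, hu, rfl, hz⟩
    -- A coboundary is the displacement of a commutator in the group, so properness leaves only
    -- finitely many short ones.
    have h0 : ρ (u * a * u⁻¹ * a⁻¹) 0 = f (ρ u 0) := by
      have hL : linearPart n (ρ (u * a * u⁻¹)) = A := by
        simp only [map_mul, map_inv, hu, one_mul, inv_one, mul_one, hA]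
      have hT : ρ (u * a * u⁻¹) 0 = ρ a 0 + (ρ u 0 - A (ρ u 0)) := by
        rw [map_mul, map_mul, map_inv, conj_translation_apply_zero hu]
      rw [map_mul, mul_apply_zero, hL, hT, map_inv, inv_apply_zero, map_neg,
        show A ((linearPart n (ρ a))⁻¹ (ρ a 0)) = ρ a 0 from
          LinearIsometryEquiv.apply_symm_apply _ _, hf]
      abel
    exact ⟨_, show ‖ρ (u * a * u⁻¹ * a⁻¹) 0‖ ≤ 2 * R by rwa [h0], h0⟩
  obtain ⟨D, hD0, hD⟩ := hs.exists_uniform_bound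
    (P := fun z b => ∃ t : G, linearPart n (ρ t) = 1 ∧ f (ρ t 0) = z ∧ ‖ρ t 0‖ ≤ b)
    (fun _ _ _ hbc ⟨t, h1, h2, h3⟩ => ⟨t, h1, h2, h3.trans hbc⟩)
    (fun _ ⟨u, h1, h2, _⟩ => ⟨_, u, h1, h2, le_rfl⟩)
  refine ⟨c + R + D, fun u hu => ?_⟩
  obtain ⟨y, hy, hyn⟩ := hc ⟨f (ρ u 0), LinearMap.mem_range_self _ _⟩
  have hy' : f y = f (ρ u 0) := congrArg Subtype.val hy
  obtain ⟨t, ht, hty⟩ := hR y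
  have hut : linearPart n (ρ (t⁻¹ * u)) = 1 := by
    rw [map_mul, map_inv, map_mul, map_inv, ht, hu, inv_one, one_mul]
  have hut0 : ρ (t⁻¹ * u) 0 = ρ u 0 - ρ t 0 := by
    rw [map_mul, map_inv, mul_apply_zero, map_inv, inv_apply_zero, ht, sub_eq_add_neg]
    rfl
  -- Replacing `y` by the nearby translation `t` costs a coboundary of norm at most `2 * R`, which
  -- one of finitely many chosen translations `w` corrects.
  obtain ⟨w, hw, hwf, hwn⟩ := hD (f (ρ u 0 - ρ t 0)) ⟨_, hut, by rw [hut0], by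
    have h1 : f (ρ u 0 - ρ t 0) = A (ρ t 0 - y) - (ρ t 0 - y) := by
      rw [map_sub, ← hy', ← map_sub, hf, map_sub, map_sub]
      abel
    have h2 := norm_sub_le (A (ρ t 0 - y)) (ρ t 0 - y)
    rw [LinearIsometryEquiv.norm_map] at h2
    rw [h1]
    linarith⟩
  have htw : ρ (t * w) 0 = ρ w 0 + ρ t 0 := by
    rw [map_mul, mul_apply_zero, ht]
    rfl
  refine ⟨t * w, by rw [map_mul, map_mul, ht, hw, one_mul], ?_, ?_⟩
  · rw [← hf, ← hf, htw, map_add, hwf, map_sub, sub_add_cancel]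
  · have h1 := norm_add_le (ρ w 0) (ρ t 0)
    have h2 := norm_add_le (ρ t 0 - y) y
    rw [sub_add_cancel] at h2
    have h3 : ‖y‖ ≤ c * ‖f (ρ u 0)‖ := hyn
    have h4 : 0 ≤ ‖f (ρ u 0)‖ := norm_nonneg _
    rw [htw, ← hf]
    nlinarith [mul_nonneg hR0 h4, mul_nonneg hD0 h4]

/-- The upper bound: conjugate elements are conjugate by an element of linearly bounded
displacement. -/
theorem IsGeometricAction.exists_short_conjugator (hρ : IsGeometricAction ρ)
    (hinj : Function.Injective ρ) (hfin : (Set.range fun g => linearPart n (ρ g)).Finite) :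
    ∃ C : ℝ, 0 ≤ C ∧ ∀ h h' : G, IsConj h h' → ∃ k : G, k * h * k⁻¹ = h' ∧
      ‖ρ k 0‖ ≤ C * (‖ρ h 0‖ + ‖ρ h' 0‖ + 1) := by
  obtain ⟨F, hF, hsec⟩ := exists_finite_section hfin
  obtain ⟨D, hD0, hD⟩ := hF.exists_uniform_bound (P := fun r c => ‖ρ r 0‖ ≤ c)
    (fun _ _ _ hbc h => h.trans hbc) fun r _ => ⟨_, le_rfl⟩
  obtain ⟨C, hC0, hC⟩ := hfin.exists_uniform_bound (P := fun A c => ∀ u : G,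
      linearPart n (ρ u) = 1 → ∃ t : G, linearPart n (ρ t) = 1 ∧
        ρ t 0 - A (ρ t 0) = ρ u 0 - A (ρ u 0) ∧ ‖ρ t 0‖ ≤ c * (‖ρ u 0 - A (ρ u 0)‖ + 1)) (by
    intro A b c hbc h u hu
    obtain ⟨t, h1, h2, h3⟩ := h u hu
    exact ⟨t, h1, h2, h3.trans (by gcongr)⟩) (by
    rintro _ ⟨a, rfl⟩
    exact hρ.exists_translation_norm_le hfin a)
  refine ⟨C * (2 * D + 1) + D, by positivity, fun h h' hh => ?_⟩
  obtain ⟨k, rfl⟩ := isConj_iff.mp hh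
  obtain ⟨r, hr, hu⟩ := hsec k
  obtain ⟨u, rfl⟩ : ∃ u, k = u * r := ⟨k * r⁻¹, by simp⟩
  rw [mul_inv_cancel_right] at hu
  set g := r * h * r⁻¹ with hg
  have hk : u * r * h * (u * r)⁻¹ = u * g * u⁻¹ := by rw [hg]; group
  rw [hk]
  -- Since `t` and `u` have the same coboundary, they conjugate `g` to the same element.
  obtain ⟨t, ht, hteq, htn⟩ := hC _ ⟨g, rfl⟩ u hu
  have hug := conj_translation_apply_zero hu (ρ g)
  have htg := conj_translation_apply_zero ht (ρ g)
  rw [← map_inv, ← map_mul, ← map_mul] at hug htg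
  refine ⟨t * r, ?_, ?_⟩
  · apply hinj
    have : t * r * h * (t * r)⁻¹ = t * g * t⁻¹ := by rw [hg]; group
    rw [this]
    apply ext_of_linearPart
    · simp only [map_mul, map_inv, ht, hu]
    · rw [htg, hug]
      exact congrArg (ρ g 0 + ·) hteq
  · have h1 := norm_mul_apply_zero_le (ρ t) (ρ r)
    have h2 := hD r hr
    have h3 := norm_conj_apply_zero_le (ρ r) (ρ h)
    rw [← map_mul] at h1
    rw [← map_inv, ← map_mul, ← map_mul] at h3
    -- The coboundary is the difference of the two translation parts.
    have h4 : ‖ρ u 0 - linearPart n (ρ g) (ρ u 0)‖ ≤ ‖ρ (u * g * u⁻¹) 0‖ + ‖ρ g 0‖ := by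
      rw [eq_sub_of_add_eq' hug.symm]
      exact norm_sub_le _ _
    have h5 : C * (‖ρ u 0 - linearPart n (ρ g) (ρ u 0)‖ + 1) ≤
        C * (‖ρ (u * g * u⁻¹) 0‖ + (2 * D + ‖ρ h 0‖) + 1) := by
      gcongr
      linarith
    have h6 := norm_nonneg (ρ h 0)
    have h7 := norm_nonneg (ρ (u * g * u⁻¹) 0)
    nlinarith [mul_nonneg (mul_nonneg hC0 hD0) h6, mul_nonneg (mul_nonneg hC0 hD0) h7,
      mul_nonneg hD0 h6, mul_nonneg hD0 h7]

theorem IsGeometricAction.conjugatorLengthFunction_le_linear (hρ : IsGeometricAction ρ)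
    (hinj : Function.Injective ρ) (hfin : (Set.range fun g => linearPart n (ρ g)).Finite)
    {S : Set G} (hSfin : S.Finite) (hS : Subgroup.closure S = ⊤) :
    QuasiDominated (conjugatorLengthFunction S) (fun m => m) := by
  obtain ⟨C, hC0, hC⟩ := hρ.exists_short_conjugator hinj hfin
  obtain ⟨M, hM⟩ := exists_norm_le_mul_wordLength ρ hSfin hS
  obtain ⟨B, hB⟩ := hρ.exists_wordLength_le hS
  refine QuasiDominated.of_le_affine (a := B * (⌈C⌉₊ * M)) (b := B * (⌈C⌉₊ + 2)) fun m => ?_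
  obtain ⟨h, h', hh, hm, hlen⟩ := (isGreatest_conjugatorLengthFunction S hSfin hS m).1
  obtain ⟨k, hk, hkn⟩ := hC h h' hh
  rw [← hlen]
  refine (conjugatorLength_le hk).trans ?_
  have hm' : (wordLength S h : ℝ) + wordLength S h' ≤ m := by exact_mod_cast hm
  have h1 : ‖ρ k 0‖ ≤ ⌈C⌉₊ * (M * m + 1) := by
    refine hkn.trans ?_
    gcongr
    · exact Nat.le_ceil C
    · have : (M : ℝ) * (wordLength S h + wordLength S h') ≤ M * m := by gcongr
      linarith [hM h, hM h']
  have h2 : (wordLength S k : ℝ) ≤ B * (⌈C⌉₊ * (M * m + 1) + 2) := (hB k).trans (by gcongr)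
  have h3 : (wordLength S k : ℝ) ≤ ((B * (⌈C⌉₊ * M) * m + B * (⌈C⌉₊ + 2) : ℕ) : ℝ) := by
    push_cast
    linarith
  exact_mod_cast h3

/-! ### The linear lower bound -/

/-- In a non-abelian group some linear part moves some translation. -/
theorem IsGeometricAction.exists_translation_moved (hρ : IsGeometricAction ρ)
    (hinj : Function.Injective ρ) (hfin : (Set.range fun g => linearPart n (ρ g)).Finite)
    (hna : ∃ a b : G, a * b ≠ b * a) :
    ∃ h t : G, linearPart n (ρ t) = 1 ∧ ρ t 0 - linearPart n (ρ h) (ρ t 0) ≠ 0 := by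
  by_contra! hcon
  obtain ⟨R, -, hR⟩ := hρ.translations_coarselyDense hfin
  have htriv : ∀ g, linearPart n (ρ g) = 1 := fun g =>
    eq_one_of_fixes_coarselyDense (T := {v | ∃ t, linearPart n (ρ t) = 1 ∧ ρ t 0 = v}) (R := R)
      (fun x => by
        obtain ⟨t, ht, hx⟩ := hR x
        exact ⟨_, ⟨t, ht, rfl⟩, hx⟩)
      (by
        rintro _ ⟨t, ht, rfl⟩
        exact (sub_eq_zero.mp (hcon g t ht)).symm)
  obtain ⟨a, b, hab⟩ := hna
  refine hab (hinj (ext_of_linearPart (by rw [htriv, htriv]) ?_))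
  rw [map_mul, map_mul, mul_apply_zero, mul_apply_zero, htriv, htriv]
  exact add_comm _ _

theorem IsGeometricAction.linear_le_conjugatorLengthFunction (hρ : IsGeometricAction ρ)
    (hinj : Function.Injective ρ) (hfin : (Set.range fun g => linearPart n (ρ g)).Finite)
    (hna : ∃ a b : G, a * b ≠ b * a) {S : Set G} (hSfin : S.Finite)
    (hS : Subgroup.closure S = ⊤) :
    QuasiDominated (fun m => m) (conjugatorLengthFunction S) := by
  obtain ⟨h, t, ht, hne⟩ := hρ.exists_translation_moved hinj hfin hna
  obtain ⟨M, hM⟩ := exists_norm_le_mul_wordLength ρ hSfin hS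
  set z := ρ t 0 - linearPart n (ρ h) (ρ t 0) with hz
  obtain ⟨q, hq⟩ := exists_nat_gt (1 / ‖z‖)
  have hzpos : 0 < ‖z‖ := norm_pos_iff.mpr hne
  rw [div_lt_iff₀ hzpos] at hq
  set a := wordLength S h with ha
  set b := wordLength S t with hb
  -- The terms `2 * b` and `2 * a` make room for the pair `h`, `t ^ m * h * (t ^ m)⁻¹`; the terms
  -- with `q * M` are the coefficients in the final estimate `h6`, where `q` clears `1 / ‖z‖`.
  refine ⟨2 * b + 2 * q * M + 1, 2 * a + 2 * q * M * a, by omega, fun m => ?_⟩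
  set N := (2 * b + 2 * q * M + 1) * m + (2 * a + 2 * q * M * a) with hN
  have hconj : IsConj h (t ^ m * h * (t ^ m)⁻¹) := isConj_iff.mpr ⟨_, rfl⟩
  have hle : wordLength S h + wordLength S (t ^ m * h * (t ^ m)⁻¹) ≤ N := by
    have h1 := wordLength_conj_le hS (t ^ m) h
    have h2 := wordLength_pow_le hS t m
    rw [hN]
    nlinarith [Nat.zero_le (q * M * m), Nat.zero_le (q * M * a)]
  have hmax := (isGreatest_conjugatorLengthFunction S hSfin hS N).2 ⟨h, _, hconj, hle, rfl⟩
  obtain ⟨k, hk, hkl⟩ := exists_conjugator S hconj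
  rw [← hkl] at hmax
  have htm : linearPart n (ρ (t ^ m)) = 1 := by rw [map_pow, map_pow, ht, one_pow]
  have hdisp : ρ (t ^ m * h * (t ^ m)⁻¹) 0 = ρ h 0 + (m : ℝ) • z := by
    rw [map_mul, map_mul, map_inv, conj_translation_apply_zero htm, map_pow,
      translation_pow_apply_zero ht, map_smul, ← smul_sub]
  have h1 : ‖(m : ℝ) • z‖ ≤ ‖ρ (t ^ m * h * (t ^ m)⁻¹) 0‖ + ‖ρ h 0‖ := by
    rw [eq_sub_of_add_eq' hdisp.symm]
    exact norm_sub_le _ _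
  rw [norm_smul, Real.norm_natCast] at h1
  have h2 := hM (t ^ m * h * (t ^ m)⁻¹)
  have h3 : wordLength S (t ^ m * h * (t ^ m)⁻¹) ≤ 2 * conjugatorLengthFunction S N + a := by
    have := wordLength_conj_le hS k h
    rw [hk] at this
    omega
  have h4 : (m : ℝ) * ‖z‖ ≤ (M * (2 * conjugatorLengthFunction S N + a) + M * a : ℕ) := by
    have h5 : (M : ℝ) * wordLength S (t ^ m * h * (t ^ m)⁻¹) ≤
        M * (2 * conjugatorLengthFunction S N + a : ℕ) := by gcongr
    have h6 := hM h
    push_cast at h5 ⊢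
    linarith
  have h5 : (m : ℝ) ≤ (q * (M * (2 * conjugatorLengthFunction S N + a) + M * a) : ℕ) := by
    rw [Nat.cast_mul]
    calc (m : ℝ) ≤ m * (q * ‖z‖) := le_mul_of_one_le_right (Nat.cast_nonneg m) hq.le
      _ = q * (m * ‖z‖) := by ring
      _ ≤ _ := by gcongr
  have h6 : m ≤ q * (M * (2 * conjugatorLengthFunction S N + a) + M * a) := by exact_mod_cast h5
  refine h6.trans ?_
  nlinarith [Nat.zero_le (b * conjugatorLengthFunction S N),
    Nat.zero_le (conjugatorLengthFunction S N)]

theorem IsGeometricAction.growsLinearly (hρ : IsGeometricAction ρ)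
    (hinj : Function.Injective ρ) (hfin : (Set.range fun g => linearPart n (ρ g)).Finite)
    (hna : ∃ a b : G, a * b ≠ b * a) {S : Set G} (hSfin : S.Finite)
    (hS : Subgroup.closure S = ⊤) : GrowsLinearly (conjugatorLengthFunction S) :=
  ⟨hρ.conjugatorLengthFunction_le_linear hinj hfin hSfin hS,
    hρ.linear_le_conjugatorLengthFunction hinj hfin hna hSfin hS⟩

/-- The point group of a split crystallographic group is finite. -/
theorem IsSplit.finite_range_linearPart {H : Subgroup (EuclideanIsometryGroup n)}
    (hcr : IsCrystallographic H) (hsplit : IsSplit H) :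
    (Set.range fun g : H => linearPart n (H.subtype g)).Finite := by
  obtain ⟨o, ho⟩ := hsplit
  refine ((hcr.properlyDiscontinuous {o} isCompact_singleton).image (linearPart n)).subset ?_
  rintro _ ⟨⟨h, hh⟩, rfl⟩
  obtain ⟨v, u, -, hu, huo, rfl⟩ := ho h hh
  refine ⟨u, ⟨hu, o, rfl, huo⟩, ?_⟩
  ext1 x
  rfl

end VirtuallyAbelian

/-! ### Groups generated by reflections have a finite point group -/

section Reflections

variable {n : ℕ}

/-- `f` is the orthogonal reflection in `{x | ⟪v, x⟫ = c}` for the unit vector `v` and some `c`. -/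
def IsUnitNormal (f : EuclideanIsometryGroup n) (v : EuclideanSpace ℝ (Fin n)) : Prop :=
  ‖v‖ = 1 ∧ ∃ c : ℝ, ∀ x, f x = x - (2 * (inner ℝ v x - c)) • v

theorem IsUnitNormal.linearPart_apply {f : EuclideanIsometryGroup n}
    {v : EuclideanSpace ℝ (Fin n)} (h : IsUnitNormal f v) (x : EuclideanSpace ℝ (Fin n)) :
    linearPart n f x = x - (2 * inner ℝ v x) • v := by
  obtain ⟨-, c, hc⟩ := h
  have hx := apply_eq_linearPart_add f x
  rw [hc x, hc 0, inner_zero_right] at hx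
  rw [eq_sub_of_add_eq hx.symm]
  module

/-- Evaluating the common linear part at `v` shows that `v` is a multiple of `w`. Thus a finite set
of reflections has finitely many unit normals. -/
theorem IsUnitNormal.eq_or_eq_neg {f : EuclideanIsometryGroup n}
    {v w : EuclideanSpace ℝ (Fin n)} (hv : IsUnitNormal f v) (hw : IsUnitNormal f w) :
    v = w ∨ v = -w := by
  have h := (hv.linearPart_apply v).symm.trans (hw.linearPart_apply v)
  rw [real_inner_self_eq_norm_sq, hv.1] at h
  have h1 : v = (inner ℝ w v : ℝ) • w := by
    have h2 : (2 : ℝ) • v = (2 : ℝ) • ((inner ℝ w v : ℝ) • w) := by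
      rw [smul_smul]
      simpa using h
    exact smul_right_injective _ two_ne_zero h2
  have h3 : |(inner ℝ w v : ℝ)| = 1 := by
    have := congrArg norm h1
    rwa [norm_smul, hv.1, hw.1, mul_one, Real.norm_eq_abs, eq_comm] at this
  rcases (abs_eq zero_le_one).mp h3 with h4 | h4 <;> rw [h4] at h1
  · exact Or.inl (by simpa using h1)
  · exact Or.inr (by simpa using h1)

theorem IsUnitNormal.conj {f : EuclideanIsometryGroup n} {v : EuclideanSpace ℝ (Fin n)}
    (h : IsUnitNormal f v) (k : EuclideanIsometryGroup n) :
    IsUnitNormal (k * f * k⁻¹) (linearPart n k v) := by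
  obtain ⟨hv, c, hc⟩ := h
  refine ⟨by rw [LinearIsometryEquiv.norm_map, hv], c + inner ℝ (linearPart n k v) (k 0),
    fun y => ?_⟩
  obtain ⟨x, rfl⟩ := k.surjective y
  have h1 : (k * f * k⁻¹) (k x) = k (f x) := congrArg (fun z => k (f z)) (k.symm_apply_apply x)
  have h2 : (inner ℝ (linearPart n k v) (k x) : ℝ) =
      inner ℝ v x + inner ℝ (linearPart n k v) (k 0) := by
    rw [apply_eq_linearPart_add k x, inner_add_right, LinearIsometryEquiv.inner_map_map]
  rw [h1, hc, h2, sub_eq_add_neg, add_comm, linearPart_apply_add, map_neg, map_smul]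
  rw [show (inner ℝ v x + inner ℝ (linearPart n k v) (k 0) -
    (c + inner ℝ (linearPart n k v) (k 0)) : ℝ) = inner ℝ v x - c by ring]
  abel

theorem IsUnitNormal.apply_eq_self {f : EuclideanIsometryGroup n}
    {v x : EuclideanSpace ℝ (Fin n)} {c : ℝ} (hc : ∀ x, f x = x - (2 * (inner ℝ v x - c)) • v)
    (hx : inner ℝ v x = c) : f x = x := by
  rw [hc, hx, sub_self, mul_zero, zero_smul, sub_zero]

/-- The reflections with two non-parallel unit normals have a common fixed point. -/
theorem IsUnitNormal.exists_common_fixedPoint {f g : EuclideanIsometryGroup n}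
    {v w : EuclideanSpace ℝ (Fin n)} (hf : IsUnitNormal f v) (hg : IsUnitNormal g w)
    (hvw : (inner ℝ v w : ℝ) ^ 2 ≠ 1) : ∃ x, f x = x ∧ g x = x := by
  obtain ⟨hv, c, hc⟩ := hf
  obtain ⟨hw, d, hd⟩ := hg
  set p : ℝ := inner ℝ v w with hp
  have hp1 : 1 - p ^ 2 ≠ 0 := sub_ne_zero.mpr (Ne.symm hvw)
  -- Cramer's rule in the span of `v` and `w`, whose Gram determinant is `1 - p ^ 2`.
  refine ⟨((c - p * d) / (1 - p ^ 2)) • v + ((d - p * c) / (1 - p ^ 2)) • w,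
    IsUnitNormal.apply_eq_self hc ?_, IsUnitNormal.apply_eq_self hd ?_⟩
  · rw [inner_add_right, inner_smul_right, inner_smul_right, real_inner_self_eq_norm_sq, hv, ← hp]
    field_simp
    ring
  · rw [inner_add_right, inner_smul_right, inner_smul_right, real_inner_self_eq_norm_sq, hw,
      real_inner_comm, ← hp]
    field_simp
    ring

/-- The unit normals of the reflections in `H`. -/
def unitNormals (H : Subgroup (EuclideanIsometryGroup n)) : Set (EuclideanSpace ℝ (Fin n)) :=
  {v | ∃ f ∈ H, IsUnitNormal f v}

theorem linearPart_mem_unitNormals {H : Subgroup (EuclideanIsometryGroup n)}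
    {k : EuclideanIsometryGroup n} (hk : k ∈ H) {v : EuclideanSpace ℝ (Fin n)}
    (hv : v ∈ unitNormals H) : linearPart n k v ∈ unitNormals H := by
  obtain ⟨f, hf, hfv⟩ := hv
  exact ⟨_, H.mul_mem (H.mul_mem hk hf) (H.inv_mem hk), hfv.conj k⟩

theorem finite_setOf_isUnitNormal (f : EuclideanIsometryGroup n) :
    {v | IsUnitNormal f v}.Finite := by
  rcases Set.eq_empty_or_nonempty {v | IsUnitNormal f v} with h | ⟨w, hw⟩
  · rw [h]
    exact Set.finite_empty
  · exact (Set.toFinite {w, -w}).subset fun v hv => hv.eq_or_eq_neg hw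

/-- Up to conjugacy, two non-parallel reflections lie in one of finitely many point stabilizers. -/
theorem IsCrystallographic.finite_inner_unitNormals {H : Subgroup (EuclideanIsometryGroup n)}
    (hH : IsCrystallographic H) :
    {p : ℝ | ∃ v ∈ unitNormals H, ∃ w ∈ unitNormals H, inner ℝ v w = p}.Finite := by
  obtain ⟨K, hK, hcov⟩ := hH.cocompact
  set F := {h : EuclideanIsometryGroup n | h ∈ H ∧ ∃ x ∈ K, h x ∈ K} with hF
  have hFfin : F.Finite := hH.properlyDiscontinuous K hK
  set N : Set (EuclideanSpace ℝ (Fin n)) := ⋃ f ∈ F, {v | IsUnitNormal f v} with hN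
  have hNfin : N.Finite := hFfin.biUnion fun f _ => finite_setOf_isUnitNormal f
  refine ((Set.Finite.image2 (fun v w => (inner ℝ v w : ℝ)) hNfin hNfin).union
    (Set.toFinite {1, -1})).subset ?_
  rintro p ⟨v, ⟨f, hf, hfv⟩, w, ⟨g, hg, hgw⟩, rfl⟩
  by_cases hvw : (inner ℝ v w : ℝ) ^ 2 = 1
  · exact Or.inr (mul_self_eq_one_iff.mp ((pow_two _).symm.trans hvw))
  · obtain ⟨x, hfx, hgx⟩ := hfv.exists_common_fixedPoint hgw hvw
    obtain ⟨k, hk, hkx⟩ := hcov x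
    -- Moving the common fixed point into `K` puts both conjugates in the finite set `F`, and
    -- `linearPart n k` preserves inner products.
    have key : ∀ e ∈ H, e x = x → k * e * k⁻¹ ∈ F := by
      intro e he hex
      have h1 : (k * e * k⁻¹) (k x) = k x := by
        have := congrArg (fun z => k (e z)) (k.symm_apply_apply x)
        exact this.trans (congrArg k hex)
      exact ⟨H.mul_mem (H.mul_mem hk he) (H.inv_mem hk), k x, hkx, by rwa [h1]⟩
    refine Or.inl ⟨linearPart n k v, Set.mem_biUnion (key f hf hfx) (hfv.conj k),
      linearPart n k w, Set.mem_biUnion (key g hg hgx) (hgw.conj k), ?_⟩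
    exact LinearIsometryEquiv.inner_map_map _ _ _

/-- A set of unit vectors with finitely many mutual inner products is finite. -/
theorem finite_of_finite_inner {Φ : Set (EuclideanSpace ℝ (Fin n))} (hunit : ∀ v ∈ Φ, ‖v‖ = 1)
    (hfin : {p : ℝ | ∃ v ∈ Φ, ∃ w ∈ Φ, inner ℝ v w = p}.Finite) : Φ.Finite := by
  by_contra hinf
  obtain ⟨x, -, hx⟩ := Set.Infinite.exists_accPt_of_subset_isCompact hinf
    (isCompact_closedBall (0 : EuclideanSpace ℝ (Fin n)) 1)
    (fun v hv => by simpa using (hunit v hv).le)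
  obtain ⟨ε, hε, hsep⟩ : ∃ ε > 0, ∀ v ∈ Φ, ∀ w ∈ Φ, dist v w < ε → v = w := by
    -- Finiteness isolates the value 1, and `‖v - w‖ ^ 2 = 2 - 2⟪v, w⟫`, so sufficiently close unit
    -- vectors of `Φ` coincide.
    have hopen : IsOpen ({p : ℝ | ∃ v ∈ Φ, ∃ w ∈ Φ, inner ℝ v w = p} \ {1})ᶜ :=
      (hfin.subset Set.sdiff_subset).isClosed.isOpen_compl
    obtain ⟨δ, hδ, hball⟩ := Metric.isOpen_iff.mp hopen 1 (by simp)
    refine ⟨min 1 δ, by positivity, fun v hv w hw hd => ?_⟩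
    have h1 : ‖v - w‖ ^ 2 = 2 - 2 * inner ℝ v w := by
      rw [norm_sub_sq_real, hunit v hv, hunit w hw]
      ring
    rw [dist_eq_norm, lt_min_iff] at hd
    have h0 := norm_nonneg (v - w)
    have h2 : (inner ℝ v w : ℝ) ∈ Metric.ball (1 : ℝ) δ := by
      rw [Metric.mem_ball, Real.dist_eq, abs_lt]
      constructor <;> nlinarith
    have h3 : (inner ℝ v w : ℝ) = 1 := by
      by_contra hne
      exact hball h2 ⟨⟨v, hv, w, hw, rfl⟩, hne⟩
    rw [h3] at h1
    have h4 : ‖v - w‖ = 0 := by nlinarith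
    exact sub_eq_zero.mp (norm_eq_zero.mp h4)
  rw [accPt_iff_nhds] at hx
  obtain ⟨v, ⟨hv, hvΦ⟩, hvx⟩ := hx _ (Metric.ball_mem_nhds x (half_pos hε))
  -- Taken strictly closer to `x` than `v`, so `w` cannot equal `v`.
  obtain ⟨w, ⟨hw, hwΦ⟩, hwx⟩ := hx _ (Metric.ball_mem_nhds x
    (lt_min (half_pos hε) (dist_pos.mpr hvx)))
  rw [Metric.mem_ball] at hv hw
  rw [lt_min_iff] at hw
  have hvw : v = w := hsep v hvΦ w hwΦ (by
    have := dist_triangle_right v w x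
    linarith [hw.1])
  rw [hvw] at hw
  exact lt_irrefl _ hw.2

/-- The point group maps the finite set of unit normals to itself. It fixes their orthogonal
complement pointwise, because the generating reflections do, so its action on the normals determines
each element. -/
theorem IsCrystallographic.finite_range_linearPart {H : Subgroup (EuclideanIsometryGroup n)}
    (hH : IsCrystallographic H)
    (hgen : Subgroup.closure {r : EuclideanIsometryGroup n | r ∈ H ∧ IsAffineReflection r} = H) :
    (linearPart n '' H).Finite := by
  have hΦ : (unitNormals H).Finite :=
    finite_of_finite_inner (fun v ⟨_, _, hv⟩ => hv.1) hH.finite_inner_unitNormals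
  have hfix : ∀ g ∈ H, ∀ x, (∀ v ∈ unitNormals H, inner ℝ v x = (0 : ℝ)) →
      linearPart n g x = x := by
    intro g hg x hx
    rw [← hgen] at hg
    induction hg using Subgroup.closure_induction with
    | mem r hr =>
      obtain ⟨hrH, v, c, hv, hc⟩ := hr
      have hr' : IsUnitNormal r v := ⟨hv, c, hc⟩
      rw [hr'.linearPart_apply, hx v ⟨r, hrH, hr'⟩, mul_zero, zero_smul, sub_zero]
    | one => rfl
    | mul a b _ _ ha hb =>
      rw [map_mul]
      exact (congrArg (linearPart n a) hb).trans ha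
    | inv a _ ha =>
      rw [map_inv]
      exact (LinearIsometryEquiv.symm_apply_eq _).mpr ha.symm
  have : Finite (unitNormals H) := hΦ
  let act : linearPart n '' H → unitNormals H → unitNormals H := fun A v => ⟨A.1 v, by
    obtain ⟨_, g, hg, rfl⟩ := A
    exact linearPart_mem_unitNormals hg v.2⟩
  refine Set.finite_coe_iff.mp (Finite.of_injective act ?_)
  rintro ⟨_, g, hg, rfl⟩ ⟨_, g', hg', rfl⟩ heq
  have hact : ∀ v ∈ unitNormals H, linearPart n g v = linearPart n g' v := fun v hv =>
    congrArg Subtype.val (congrFun heq ⟨v, hv⟩)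
  refine Subtype.ext (LinearIsometryEquiv.ext fun x => ?_)
  set U := Submodule.span ℝ (unitNormals H)
  obtain ⟨y, hy, z, hz, rfl⟩ := U.exists_add_mem_mem_orthogonal x
  have hy' : linearPart n g y = linearPart n g' y := by
    induction hy using Submodule.span_induction with
    | mem v hv => exact hact v hv
    | zero => rw [map_zero, map_zero]
    | add a b _ _ ha hb => rw [map_add, map_add, ha, hb]
    | smul c a _ ha => rw [map_smul, map_smul, ha]
  have hz' : ∀ v ∈ unitNormals H, inner ℝ v z = (0 : ℝ) := fun v hv =>
    (Submodule.mem_orthogonal U z).mp hz v (Submodule.subset_span hv)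
  change linearPart n g (y + z) = linearPart n g' (y + z)
  rw [map_add, map_add, hy', hfix g hg z hz', hfix g' hg' z hz']

theorem IsAffineReflection.mul_self {r : EuclideanIsometryGroup n} (hr : IsAffineReflection r) :
    r * r = 1 := by
  obtain ⟨v, c, hv, hc⟩ := hr
  ext1 x
  change r (r x) = x
  have h : (inner ℝ v (r x) : ℝ) = 2 * c - inner ℝ v x := by
    rw [hc x, inner_sub_right, inner_smul_right, real_inner_self_eq_norm_sq, hv]
    ring
  rw [hc (r x), h, hc x]
  module

/-- A cocompact reflection group in positive dimension is not abelian. -/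
theorem IsGeometricAction.exists_mul_ne_mul {G : Type*} [Group G]
    {ρ : G →* EuclideanIsometryGroup n} (hρ : IsGeometricAction ρ) (hn : 1 ≤ n)
    (hfin : (Set.range fun g => linearPart n (ρ g)).Finite)
    (hgen : Subgroup.closure {r | r ∈ ρ.range ∧ IsAffineReflection r} = ρ.range) :
    ∃ a b : G, a * b ≠ b * a := by
  by_contra! hcomm
  -- Commuting involutions generate a group of exponent two, which has no nontrivial translations;
  -- this contradicts their coarse density.
  have hsq : ∀ e ∈ ρ.range, e * e = 1 := by
    have hcomm' : ∀ a ∈ ρ.range, ∀ b ∈ ρ.range, a * b = b * a := by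
      rintro _ ⟨a, rfl⟩ _ ⟨b, rfl⟩
      rw [← map_mul, hcomm, map_mul]
    intro e he
    rw [← hgen] at he
    induction he using Subgroup.closure_induction with
    | mem r hr => exact hr.2.mul_self
    | one => exact one_mul 1
    | mul a b ha hb iha ihb =>
      rw [hgen] at ha hb
      rw [mul_assoc, ← mul_assoc b, hcomm' b hb a ha, mul_assoc, ihb, mul_one, iha]
    | inv a _ ih => rw [← mul_inv_rev, ih, inv_one]
  obtain ⟨R, hR0, hR⟩ := hρ.translations_coarselyDense hfin
  have hzero : ∀ t, linearPart n (ρ t) = 1 → ρ t 0 = 0 := by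
    intro t ht
    have h := translation_pow_apply_zero ht 2
    rw [pow_two, hsq _ ⟨t, rfl⟩] at h
    exact (smul_eq_zero_iff_right (by norm_num)).mp h.symm
  -- A vector of norm `R + 1`, which needs a coordinate to exist, is too far from the only
  -- translation vector 0.
  let x : EuclideanSpace ℝ (Fin n) := EuclideanSpace.single ⟨0, hn⟩ (R + 1)
  obtain ⟨t, ht, hx⟩ := hR x
  rw [hzero t ht, zero_sub, norm_neg, PiLp.norm_single, Real.norm_eq_abs] at hx
  linarith [le_abs_self (R + 1)]

end Reflections

theorem corollary1p2 :
    (∀ (W : Type*) [Group W], IsAffineCoxeterGroup W →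
      Group.FG W ∧
      ∀ S : Set W, S.Finite → Subgroup.closure S = ⊤ →
        GrowsLinearly (conjugatorLengthFunction S)) ∧
    (∀ (n : ℕ) (H : Subgroup (EuclideanIsometryGroup n)), IsCrystallographic H → IsSplit H →
      Group.FG H ∧
      ∀ S : Set H, S.Finite → Subgroup.closure S = ⊤ →
        ((∃ a b : H, a * b ≠ b * a) → GrowsLinearly (conjugatorLengthFunction S)) ∧
        ((∀ a b : H, a * b = b * a) → ∀ m : ℕ, conjugatorLengthFunction S m = 0)) := by
  constructor
  · rintro W _ ⟨n, ρ, hn, hinj, hcr, hgen⟩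
    have hρ := hcr.isGeometricAction hinj
    have hfin : (Set.range fun g => linearPart n (ρ g)).Finite := by
      refine (hcr.finite_range_linearPart hgen).subset ?_
      rintro _ ⟨g, rfl⟩
      exact ⟨ρ g, ⟨g, rfl⟩, rfl⟩
    exact ⟨hρ.fg, fun S hSfin hS =>
      hρ.growsLinearly hinj hfin (hρ.exists_mul_ne_mul hn hfin hgen) hSfin hS⟩
  · intro n H hcr hsplit
    have hinj : Function.Injective H.subtype := Subtype.val_injective
    have hρ : IsGeometricAction H.subtype :=
      IsCrystallographic.isGeometricAction hinj (by rwa [Subgroup.range_subtype])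
    exact ⟨hρ.fg, fun S hSfin hS => ⟨fun hna => hρ.growsLinearly hinj
      (hsplit.finite_range_linearPart hcr) hna hSfin hS,
      fun hcomm => conjugatorLengthFunction_eq_zero_of_comm hSfin hS hcomm⟩⟩
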